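/- For a positive integer $n$ and nontrivial Boolean algebras $A,B$, a function $f\colon X\to B$ on a subset $X\subseteq A$ is $n$-preserving if for all $a_0,\dots,a_{n-1}\in X$, $\prod_{i<n}a_i=0$ implies $\prod_{i<n}f(a_i)=0$. The algebra $A$ is $n$-free over $X$ if every $n$-preserving function from $X$ into an arbitrary nontrivial Boolean algebra $B$ extends to a unique homomorphism $A\to B$, and $A$ is $n$-free if it is $n$-free over some $X\subseteq A$. A set $X\subseteq A$ is $n$-independent if $0\notin X$ and for all nonempty finite $F,G\subseteq X$: (i) $\sum F\neq 1$; (ii) if $\prod F=0$, then there is $F'\subseteq F$ with $|F'|\le n$ and $\prod F'=0$; (iii) if $0\neq\prod F\le\sum G$, then $F\cap G\neq\emptyset$. Let $\mathrm{FinCo}(\omega_1)$ be the Boolean algebra of finite and cofinite subsets of $\omega_1$, and let $\mathrm{Fr}(\omega_1)$ be the free Boolean algebra on $\omega_1$ generators. Theorem. The product $\mathrm{FinCo}(\omega_1)\times\mathrm{Fr}(\omega_1)$ is not $2$-free, and it has no $2$-independent generating set. However, $\mathrm{FinCo}(\omega_1)$ and $\mathrm{Fr}(\omega_1)$ are both $2$-free,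 so a product of two $2$-free Boolean algebras need not be $2$-free. Moreover, $\mathrm{FinCo}(\omega_1)\times\mathrm{Fr}(\omega_1)$ is $3$-free. -/

import Mathlib

open scoped Ordinal

universe u

/-- `f : U → B` is `n`-preserving (`n` a positive integer): whenever `a₀, …, aₙ₋₁ ∈ U`
(repetitions allowed) have meet `0`, so do `f a₀, …, f aₙ₋₁`. -/
def IsNPreserving (n : ℕ) {A B : Type u} [BooleanAlgebra A] [BooleanAlgebra B]
    {U : Set A} (f : U → B) : Prop :=
  ∀ a : Fin n → U, (Finset.univ.inf fun i => (a i : A)) = ⊥ →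
    (Finset.univ.inf fun i => f (a i)) = ⊥

/-- `A` is `n`-free over `X`: every `n`-preserving function from `X` into a nontrivial Boolean
algebra `B` extends to a unique homomorphism of Boolean algebras `A → B`. (Bounded lattice
homomorphisms between Boolean algebras are exactly the Boolean homomorphisms.) -/
def IsNFreeOver (n : ℕ) {A : Type u} [BooleanAlgebra A] (X : Set A) : Prop :=
  ∀ (B : Type u) [BooleanAlgebra B] [Nontrivial B] (f : X → B), IsNPreserving n f →
    ∃! g : BoundedLatticeHom A B, ∀ x : X, g (x : A) = f x

/-- `A` is `n`-free: it is `n`-free over some subset. -/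
def IsNFree (n : ℕ) (A : Type u) [BooleanAlgebra A] : Prop :=
  ∃ X : Set A, IsNFreeOver n X

/-- `X` is `n`-independent (`n` a positive integer). -/
def IsNIndependent (n : ℕ) {A : Type u} [BooleanAlgebra A] (X : Set A) : Prop :=
  ⊥ ∉ X ∧ ∀ F G : Finset A, F.Nonempty → G.Nonempty → (F : Set A) ⊆ X → (G : Set A) ⊆ X →
    F.sup id ≠ ⊤ ∧
    (F.inf id = ⊥ → ∃ F' : Finset A, F' ⊆ F ∧ F'.card ≤ n ∧ F'.inf id = ⊥) ∧
    (F.inf id ≠ ⊥ → F.inf id ≤ G.sup id → ∃ x, x ∈ F ∧ x ∈ G)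

/-- `X` generates `A` as a Boolean algebra. -/
def GeneratesBA {A : Type u} [BooleanAlgebra A] (X : Set A) : Prop :=
  BooleanSubalgebra.closure X = ⊤

/-- The finite-cofinite algebra on `κ`. -/
def FinCo (κ : Type u) : BooleanSubalgebra (Set κ) where
  carrier := {s | s.Finite ∨ sᶜ.Finite}
  supClosed' := by
    rintro s (hs | hs) t (ht | ht)
    · exact Or.inl (hs.union ht)
    · exact Or.inr (ht.subset (Set.compl_subset_compl.2 Set.subset_union_right))
    · exact Or.inr (hs.subset (Set.compl_subset_compl.2 Set.subset_union_left))
    · exact Or.inr (hs.subset (Set.compl_subset_compl.2 Set.subset_union_left))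
  infClosed' := by
    rintro s (hs | hs) t (ht | ht)
    · exact Or.inl (hs.subset Set.inter_subset_left)
    · exact Or.inl (hs.subset Set.inter_subset_left)
    · exact Or.inl (ht.subset Set.inter_subset_right)
    · refine Or.inr ?_
      change ((s ∩ t)ᶜ).Finite
      rw [Set.compl_inter]
      exact hs.union ht
  compl_mem' := by
    rintro s (hs | hs)
    · exact Or.inr (by rwa [compl_compl])
    · exact Or.inl hs
  bot_mem' := Or.inl Set.finite_empty

/-- The free Boolean algebra on the generators `{p | p α = true}` (`α : κ`), in its standard
realization as the algebra of subsets of the Cantor cube `2^κ` generated by the coordinate sets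
(equivalently, the clopen algebra of `2^κ`). -/
def FreeBA (κ : Type u) : BooleanSubalgebra (Set (κ → Bool)) :=
  BooleanSubalgebra.closure (Set.range fun α : κ => {p : κ → Bool | p α = true})

/-- The first uncountable ordinal, as a type. -/
abbrev Omega1 : Type := (ω₁ : Ordinal.{0}).ToType

/-! Both 2-freeness over `X` and 2-independence of `X` give `PairIndependent X`: a literal (a meet
of elements of `X` and complements of others) vanishes only if two of its positive members, possibly
equal, are disjoint. It remains to show that no such `X` generates the product.

Let a finite `H ⊆ X` decide `u = (⊤, ⊥)`, so that `lit ∅ H` lies below `u` or below its complement.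
Making every element of `H` negative (`negLit`) carries any nonzero literal to a nonzero one below
`lit ∅ H`. It also preserves disjointness of literals with equal signs on `H`. Structure is thus
moved from one factor to the other, where it cannot exist. If `lit ∅ H ≤ u`, the endless splitting
in the atomless free algebra moves into the finite-cofinite one, where finite sets split only
finitely often. Otherwise the uncountably many atoms move into the free algebra, against its
countable chain condition.

The positive claims come from `isNFreeOver_of_lit`. For 3-freeness the generators are `u` and the
pairs `atomGen α`, whose relations all follow from `u ⊓ atomGen α ⊓ atomGen β = ⊥` for `α ≠ β`. -/

section Literals

variable {A B : Type*} [BooleanAlgebra A] [BooleanAlgebra B]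

/-- The meet of the elements of `F` and of the complements of the elements of `G`. -/
def lit (F G : Finset A) : A := F.inf id ⊓ (G.sup id)ᶜ

theorem lit_anti {F F' G G' : Finset A} (hF : F ⊆ F') (hG : G ⊆ G') : lit F' G' ≤ lit F G :=
  inf_le_inf (Finset.inf_mono hF) (compl_le_compl (Finset.sup_mono hG))

theorem lit_le_of_mem_left {F G : Finset A} {x : A} (hx : x ∈ F) : lit F G ≤ x :=
  inf_le_left.trans (Finset.inf_le (f := id) hx)

theorem lit_le_compl_of_mem_right {F G : Finset A} {x : A} (hx : x ∈ G) : lit F G ≤ xᶜ :=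
  inf_le_right.trans (compl_le_compl (Finset.le_sup (f := id) hx))

theorem lit_eq_bot_of_mem {F G : Finset A} {x : A} (hF : x ∈ F) (hG : x ∈ G) : lit F G = ⊥ :=
  le_bot_iff.1 <| (le_inf (lit_le_of_mem_left hF) (lit_le_compl_of_mem_right hG)).trans
    inf_compl_eq_bot.le

theorem lit_union [DecidableEq A] (F F' G G' : Finset A) :
    lit (F ∪ F') (G ∪ G') = lit F G ⊓ lit F' G' := by
  simp only [lit, Finset.inf_union, Finset.sup_union, compl_sup]
  exact inf_inf_inf_comm _ _ _ _

theorem map_lit [DecidableEq B] (g : BoundedLatticeHom A B) (F G : Finset A) :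
    g (lit F G) = lit (F.image g) (G.image g) := by
  simp only [lit, map_inf, map_compl', map_finset_inf, map_finset_sup, Finset.inf_image,
    Finset.sup_image]
  rfl

/-- An element of a generated subalgebra is decided by the literals over finitely many
generators. -/
theorem exists_finset_lit_decides {X : Set A} {a : A} (ha : a ∈ BooleanSubalgebra.closure X) :
    ∃ H : Finset A, (H : Set A) ⊆ X ∧
      ∀ F G : Finset A, (∀ x ∈ H, x ∈ F ∨ x ∈ G) → lit F G ≤ a ∨ lit F G ≤ aᶜ := by
  classical
  induction ha using BooleanSubalgebra.closure_bot_sup_induction with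
  | mem x hx =>
    refine ⟨{x}, by simpa using hx, fun F G h => ?_⟩
    rcases h x (by simp) with h | h
    · exact Or.inl (lit_le_of_mem_left h)
    · exact Or.inr (lit_le_compl_of_mem_right h)
  | bot => exact ⟨∅, by simp, fun F G _ => Or.inr (by simp)⟩
  | sup x hx y hy ihx ihy =>
    obtain ⟨H, hH, h⟩ := ihx
    obtain ⟨K, hK, k⟩ := ihy
    refine ⟨H ∪ K, by simp [hH, hK], fun F G hFG => ?_⟩
    rcases h F G (fun x hx => hFG x (Finset.mem_union_left _ hx)) with h | h
    · exact Or.inl (h.trans le_sup_left)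
    rcases k F G (fun x hx => hFG x (Finset.mem_union_right _ hx)) with k | k
    · exact Or.inl (k.trans le_sup_right)
    · exact Or.inr (by rw [compl_sup]; exact le_inf h k)
  | compl x hx ih =>
    obtain ⟨H, hH, h⟩ := ih
    exact ⟨H, hH, fun F G hFG => by rw [compl_compl]; exact (h F G hFG).symm⟩

theorem exists_lit_inf_ne_bot [DecidableEq A] {a : A} (ha : a ≠ ⊥) (H : Finset A) :
    ∃ F G : Finset A, F ∪ G = H ∧ lit F G ⊓ a ≠ ⊥ := by
  induction H using Finset.induction_on with
  | empty => exact ⟨∅, ∅, by simp, by simpa [lit] using ha⟩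
  | insert x H _ ih =>
    obtain ⟨F, G, rfl, h⟩ := ih
    by_cases hx : x ⊓ (lit F G ⊓ a) = ⊥
    · refine ⟨F, insert x G, by simp, fun h0 => h ?_⟩
      have h1 : xᶜ ⊓ (lit F G ⊓ a) = ⊥ := by
        rw [← h0]; simp only [lit, Finset.sup_insert, id, compl_sup]; ac_rfl
      rw [← sup_inf_inf_compl (x := lit F G ⊓ a) (y := x), inf_comm _ x, hx, inf_comm _ xᶜ, h1,
        sup_bot_eq]
    · refine ⟨insert x F, G, by simp, fun h0 => hx ?_⟩
      rw [← h0]; simp only [lit, Finset.inf_insert, id]; ac_rfl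

/-- Literals over `X` are dense in the generated subalgebra. -/
theorem exists_lit_le {X : Set A} {a : A} (ha : a ∈ BooleanSubalgebra.closure X) (ha0 : a ≠ ⊥) :
    ∃ F G : Finset A, (F : Set A) ⊆ X ∧ (G : Set A) ⊆ X ∧ lit F G ≠ ⊥ ∧ lit F G ≤ a := by
  classical
  obtain ⟨H, hH, h⟩ := exists_finset_lit_decides ha
  obtain ⟨F, G, rfl, h0⟩ := exists_lit_inf_ne_bot ha0 H
  rw [Finset.coe_union, Set.union_subset_iff] at hH
  refine ⟨F, G, hH.1, hH.2, fun hb => h0 (by rw [hb, bot_inf_eq]), ?_⟩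
  refine (h F G fun x hx => Finset.mem_union.1 hx).resolve_right fun hc => h0 ?_
  exact (disjoint_compl_left.mono_left hc).eq_bot

/-- Every nonzero element below a literal contains a nonzero refinement of this literal. -/
theorem exists_lit_refine [DecidableEq A] {X : Set A} (hX : GeneratesBA X) {F G : Finset A}
    (hF : (F : Set A) ⊆ X) (hG : (G : Set A) ⊆ X) {a : A} (ha0 : a ≠ ⊥) (ha : a ≤ lit F G) :
    ∃ F' G' : Finset A, F ⊆ F' ∧ G ⊆ G' ∧ (F' : Set A) ⊆ X ∧ (G' : Set A) ⊆ X ∧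
      lit F' G' ≠ ⊥ ∧ lit F' G' ≤ a := by
  obtain ⟨F₁, G₁, hF₁, hG₁, h0, h1⟩ := exists_lit_le (X := X) (a := a) (by
    rw [show BooleanSubalgebra.closure X = ⊤ from hX]; trivial) ha0
  refine ⟨F ∪ F₁, G ∪ G₁, Finset.subset_union_left, Finset.subset_union_left, by simp [hF, hF₁],
    by simp [hG, hG₁], ?_, ?_⟩ <;> rw [lit_union, inf_eq_right.2 (h1.trans ha)]
  exacts [h0, h1]

/-- Every nonzero element contains a nonzero literal over a set of generators that includes a
given finite set. -/
theorem exists_lit_le_of_finset [DecidableEq A] {X : Set A} (hX : GeneratesBA X) {H : Finset A}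
    (hH : (H : Set A) ⊆ X) {a : A} (ha0 : a ≠ ⊥) :
    ∃ F G : Finset A, (F : Set A) ⊆ X ∧ (G : Set A) ⊆ X ∧ H ⊆ F ∪ G ∧
      lit F G ≠ ⊥ ∧ lit F G ≤ a := by
  obtain ⟨F, G, rfl, h0⟩ := exists_lit_inf_ne_bot ha0 H
  rw [Finset.coe_union, Set.union_subset_iff] at hH
  obtain ⟨F', G', hF, hG, hFX, hGX, h1, h2⟩ :=
    exists_lit_refine hX hH.1 hH.2 h0 inf_le_left
  exact ⟨F', G', hFX, hGX, Finset.union_subset_union hF hG, h1, h2.trans inf_le_right⟩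

end Literals

/-! ### Extension of maps from a generating set -/

section Extension

variable {A B : Type u} [BooleanAlgebra A] [BooleanAlgebra B]

theorem boundedLatticeHom_eqOn_closure {X : Set A} {g h : BoundedLatticeHom A B}
    (hgh : ∀ x ∈ X, g x = h x) {a : A} (ha : a ∈ BooleanSubalgebra.closure X) : g a = h a := by
  induction ha using BooleanSubalgebra.closure_bot_sup_induction with
  | mem x hx => exact hgh x hx
  | bot => simp
  | sup x hx y hy ihx ihy => simp [ihx, ihy]
  | compl x hx ih => rw [map_compl', map_compl', ih]

/-- A set over which an algebra is `n`-free generates it. -/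
theorem IsNFreeOver.generatesBA [Nontrivial A] {n : ℕ} {X : Set A} (h : IsNFreeOver n X) :
    GeneratesBA X := by
  let S := BooleanSubalgebra.closure X
  have : Nontrivial S := ⟨⊥, ⊤, fun h => bot_ne_top (congrArg Subtype.val h)⟩
  have hinf : ∀ a : Fin n → X, ((Finset.univ.inf fun i =>
      (⟨a i, BooleanSubalgebra.subset_closure (a i).2⟩ : S) : S) : A) =
      Finset.univ.inf fun i => (a i : A) := fun a => map_finset_inf S.subtype _ _
  -- The corestricted inclusion of `X` extends to `r : A → S`. Followed by `S ⊆ A` it must be the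
  -- identity by uniqueness, so `S` is everything.
  obtain ⟨r, hr, -⟩ := h S (fun x => ⟨x, BooleanSubalgebra.subset_closure x.2⟩)
    fun a ha => Subtype.ext (by rw [hinf, ha]; rfl)
  have huniq := (h A (fun x => x) fun a ha => ha).unique
    (y₁ := S.subtype.comp r) (y₂ := BoundedLatticeHom.id A)
    (fun x => by simp [hr]) (fun x => rfl)
  refine BooleanSubalgebra.ext fun a => ⟨fun _ => trivial, fun _ => ?_⟩
  have := DFunLike.congr_fun huniq a
  rw [← show ((r a : S) : A) = a from this]
  exact (r a).2

/-- An extension criterion in the style of Sikorski. -/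
theorem isNFreeOver_of_lit {n : ℕ} {X : Set A} (hX : GeneratesBA X)
    (h : ∀ F G : Finset A, (F : Set A) ⊆ X → (G : Set A) ⊆ X → Disjoint F G → lit F G = ⊥ →
      ∃ a : Fin n → A, (∀ i, a i ∈ F) ∧ Finset.univ.inf a = ⊥) : IsNFreeOver n X := by
  classical
  intro B _ _ f hf
  -- The subalgebra generated by the graph of `f`. It is the graph of the extension once only `⊥`
  -- lies over `⊥`.
  let Γ : BooleanSubalgebra (A × B) :=
    BooleanSubalgebra.closure (Set.range fun x : X => ((x : A), f x))
  let π : BoundedLatticeHom (A × B) A :=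
    { toFun := Prod.fst, map_sup' := fun _ _ => rfl, map_inf' := fun _ _ => rfl,
      map_top' := rfl, map_bot' := rfl }
  have hzero : ∀ z ∈ Γ, z.1 = ⊥ → z = ⊥ := by
    intro z hz hz1
    by_contra hz0
    obtain ⟨F, G, hF, hG, h0, h1⟩ := exists_lit_le hz hz0
    have himage : ∀ K : Finset (A × B), (K : Set (A × B)) ⊆ Set.range (fun x : X => ((x : A), f x)) →
        ∀ x ∈ K.image π, ∃ hx : x ∈ X, (x, f ⟨x, hx⟩) ∈ K := by
      intro K hK x hx
      obtain ⟨k, hk, rfl⟩ := Finset.mem_image.1 hx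
      obtain ⟨y, rfl⟩ := hK hk
      exact ⟨y.2, hk⟩
    have hπ : lit (F.image π) (G.image π) = ⊥ := by
      rw [← map_lit]; exact le_bot_iff.1 (hz1 ▸ OrderHomClass.mono π h1)
    obtain ⟨a, haF, ha⟩ := h _ _ (fun x hx => (himage F hF x hx).1)
      (fun x hx => (himage G hG x hx).1) (by
        rw [Finset.disjoint_left]
        intro x hxF hxG
        obtain ⟨_, h2⟩ := himage F hF x hxF
        obtain ⟨_, h3⟩ := himage G hG x hxG
        exact h0 (lit_eq_bot_of_mem h2 h3)) hπ
    choose haX haf using fun i => himage F hF (a i) (haF i)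
    have hfa := hf (fun i => ⟨a i, haX i⟩) ha
    refine h0 (le_bot_iff.1 (Prod.mk_le_mk.2 ⟨?_, ?_⟩))
    · exact ha ▸ Finset.le_inf fun i _ => (lit_le_of_mem_left (haf i)).1
    · exact hfa ▸ Finset.le_inf fun i _ => (lit_le_of_mem_left (haf i)).2
  have hex : ∀ a : A, ∃ b : B, (a, b) ∈ Γ := by
    intro a
    have ha : a ∈ BooleanSubalgebra.closure X := by
      rw [show BooleanSubalgebra.closure X = ⊤ from hX]; trivial
    induction ha using BooleanSubalgebra.closure_bot_sup_induction with
    | mem x hx => exact ⟨f ⟨x, hx⟩, BooleanSubalgebra.subset_closure ⟨⟨x, hx⟩, rfl⟩⟩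
    | bot => exact ⟨⊥, BooleanSubalgebra.bot_mem⟩
    | sup x hx y hy ihx ihy =>
      obtain ⟨b, hb⟩ := ihx
      obtain ⟨c, hc⟩ := ihy
      exact ⟨b ⊔ c, BooleanSubalgebra.sup_mem hb hc⟩
    | compl x hx ih =>
      obtain ⟨b, hb⟩ := ih
      exact ⟨bᶜ, BooleanSubalgebra.compl_mem hb⟩
  have hle : ∀ a b c, (a, b) ∈ Γ → (a, c) ∈ Γ → b ≤ c := by
    intro a b c hb hc
    have := hzero _ (BooleanSubalgebra.sdiff_mem hb hc) (sdiff_self (a := a))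
    exact sdiff_eq_bot_iff.1 (congrArg Prod.snd this)
  have huniq : ∀ a b c, (a, b) ∈ Γ → (a, c) ∈ Γ → b = c := fun a b c hb hc =>
    le_antisymm (hle a b c hb hc) (hle a c b hc hb)
  choose g hg using hex
  refine ⟨{ toFun := g
            map_sup' := fun a b => huniq _ _ _ (hg _) (BooleanSubalgebra.sup_mem (hg a) (hg b))
            map_inf' := fun a b => huniq _ _ _ (hg _) (BooleanSubalgebra.inf_mem (hg a) (hg b))
            map_top' := huniq _ _ _ (hg _) BooleanSubalgebra.top_mem
            map_bot' := huniq _ _ _ (hg _) BooleanSubalgebra.bot_mem },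
    fun x => huniq _ _ _ (hg _) (BooleanSubalgebra.subset_closure ⟨x, rfl⟩), fun k hk => ?_⟩
  refine DFunLike.ext _ _ fun a => boundedLatticeHom_eqOn_closure (X := X) (fun x hx => ?_) (by
    rw [show BooleanSubalgebra.closure X = ⊤ from hX]; trivial)
  exact (hk ⟨x, hx⟩).trans
    (huniq _ _ _ (BooleanSubalgebra.subset_closure ⟨⟨x, hx⟩, rfl⟩) (hg _))

end Extension

/-! ### The common consequence of 2-freeness and 2-independence -/

section PairIndependent

variable {A : Type} [BooleanAlgebra A]

/-- The only relations between the elements of `X` are those that follow from the disjointness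
of pairs. -/
def PairIndependent (X : Set A) : Prop :=
  ∀ F G : Finset A, (F : Set A) ⊆ X → (G : Set A) ⊆ X → Disjoint F G → lit F G = ⊥ →
    ∃ x ∈ F, ∃ y ∈ F, x ⊓ y = ⊥

/-- If no two members of `F` are disjoint, the indicator of `F` is 2-preserving into the two-element
algebra `Prop`, and its extension sends `lit F G` to `⊤`. -/
theorem IsNFreeOver.pairIndependent {X : Set A} (h : IsNFreeOver 2 X) : PairIndependent X := by
  intro F G hF hG hFG hlit
  by_contra! hne
  obtain ⟨g, hg, -⟩ := h Prop (fun x => (x : A) ∈ F) fun a ha => by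
    simp only [Fin.univ_succ, Finset.inf_cons, Finset.univ_unique, Finset.map_singleton,
      Finset.inf_singleton] at ha ⊢
    exact eq_bot_iff.2 fun hm => hne _ hm.1 _ hm.2 ha
  have h1 : g (lit F G) = ⊤ := by
    rw [lit, map_inf, map_compl', map_finset_inf, map_finset_sup, eq_top_iff]
    refine le_inf (Finset.le_inf fun x hx => ?_) (le_compl_comm.1 (Finset.sup_le fun x hx => ?_))
    · exact fun _ => (hg ⟨x, hF hx⟩).mpr hx
    · intro hgx
      have : x ∈ F := (hg ⟨x, hG hx⟩).mp hgx
      exact absurd hx (Finset.disjoint_left.1 hFG this)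
  rw [hlit, map_bot] at h1
  exact bot_ne_top h1

theorem IsNIndependent.pairIndependent [Nontrivial A] {X : Set A} (h : IsNIndependent 2 X) :
    PairIndependent X := by
  intro F G hF hG hFG hlit
  rcases F.eq_empty_or_nonempty with rfl | hFn
  · rcases G.eq_empty_or_nonempty with rfl | hGn
    · simp [lit] at hlit
    · rw [lit, Finset.inf_empty, top_inf_eq, compl_eq_bot] at hlit
      exact absurd hlit (h.2 G G hGn hGn hG hG).1
  · have hinf : F.inf id = ⊥ := by
      by_contra h0
      rcases G.eq_empty_or_nonempty with rfl | hGn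
      · exact h0 (by simpa [lit] using hlit)
      · obtain ⟨x, hx, hx'⟩ := (h.2 F G hFn hGn hF hG).2.2 h0
          (disjoint_compl_right_iff.1 (disjoint_iff.2 hlit))
        exact Finset.disjoint_left.1 hFG hx hx'
    obtain ⟨F', hF', hcard, h0⟩ := (h.2 F F hFn hFn hF hF).2.1 hinf
    have : F'.card = 0 ∨ F'.card = 1 ∨ F'.card = 2 := by omega
    rcases this with hc | hc | hc
    · rw [Finset.card_eq_zero] at hc
      subst hc
      simp at h0
    · obtain ⟨x, rfl⟩ := Finset.card_eq_one.1 hc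
      have hx : x ∈ F := hF' (by simp)
      exact ⟨x, hx, x, hx, by simpa using h0⟩
    · classical
      obtain ⟨x, y, -, rfl⟩ := Finset.card_eq_two.1 hc
      exact ⟨x, hF' (by simp), y, hF' (by simp), by simpa using h0⟩

end PairIndependent

/-! ### Two-valued homomorphisms and projections -/

section Points

variable {A : Type u} [BooleanAlgebra A]

theorem lit_ne_bot_of_hom (g : BoundedLatticeHom A Prop) {F G : Finset A}
    (hF : ∀ x ∈ F, g x) (hG : ∀ x ∈ G, ¬ g x) : lit F G ≠ ⊥ := by
  intro h
  have h1 : ⊤ ≤ g (lit F G) := by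
    rw [lit, map_inf, map_compl', map_finset_inf, map_finset_sup]
    refine le_inf (Finset.le_inf fun x hx _ => hF x hx)
      (le_compl_comm.1 (Finset.sup_le fun x hx hgx => absurd hgx (hG x hx)))
  rw [h, map_bot] at h1
  exact h1 trivial

/-- The homomorphism of evaluation at a point, on an algebra of sets. -/
def BooleanSubalgebra.evalHom {κ : Type*} (S : BooleanSubalgebra (Set κ)) (p : κ) :
    BoundedLatticeHom S Prop where
  toFun a := p ∈ (a : Set κ)
  map_sup' _ _ := rfl
  map_inf' _ _ := rfl
  map_top' := rfl
  map_bot' := rfl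

/-- The first projection of a product. -/
def BoundedLatticeHom.fstHom (A B : Type*) [BooleanAlgebra A] [BooleanAlgebra B] :
    BoundedLatticeHom (A × B) A where
  toFun := Prod.fst
  map_sup' _ _ := rfl
  map_inf' _ _ := rfl
  map_top' := rfl
  map_bot' := rfl

/-- The second projection of a product. -/
def BoundedLatticeHom.sndHom (A B : Type*) [BooleanAlgebra A] [BooleanAlgebra B] :
    BoundedLatticeHom (A × B) B where
  toFun := Prod.snd
  map_sup' _ _ := rfl
  map_inf' _ _ := rfl
  map_top' := rfl
  map_bot' := rfl

end Points

/-! ### The free algebra: finite supports, splitting, chain condition -/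

section FreeAlgebra

variable {κ : Type u}

/-- The free generators of `FreeBA κ`. -/
def FreeBA.gen (α : κ) : FreeBA κ :=
  ⟨{p | p α = true}, BooleanSubalgebra.subset_closure ⟨α, rfl⟩⟩

theorem FreeBA.generatesBA_range_gen : GeneratesBA (Set.range (FreeBA.gen (κ := κ))) := by
  refine BooleanSubalgebra.ext fun ⟨a, ha⟩ => ⟨fun _ => trivial, fun _ => ?_⟩
  refine BooleanSubalgebra.closure_bot_sup_induction
    (p := fun a ha => (⟨a, ha⟩ : FreeBA κ) ∈ BooleanSubalgebra.closure (Set.range FreeBA.gen))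
    ?_ ?_ ?_ ?_ ha
  · rintro _ ⟨α, rfl⟩
    exact BooleanSubalgebra.subset_closure ⟨α, rfl⟩
  · exact BooleanSubalgebra.bot_mem
  · exact fun x hx y hy ihx ihy => BooleanSubalgebra.sup_mem ihx ihy
  · exact fun x hx ih => BooleanSubalgebra.compl_mem ih

theorem FreeBA.exists_finset_support (a : FreeBA κ) : ∃ J : Finset κ, ∀ p q : κ → Bool,
    (∀ j ∈ J, p j = q j) → (p ∈ (a : Set (κ → Bool)) ↔ q ∈ (a : Set (κ → Bool))) := by
  classical
  obtain ⟨a, ha⟩ := a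
  change ∃ J : Finset κ, ∀ p q : κ → Bool, (∀ j ∈ J, p j = q j) → (p ∈ a ↔ q ∈ a)
  induction ha using BooleanSubalgebra.closure_bot_sup_induction with
  | mem x hx =>
    obtain ⟨α, rfl⟩ := hx
    exact ⟨{α}, fun p q h => by simp [h α (by simp)]⟩
  | bot => exact ⟨∅, fun p q _ => Iff.rfl⟩
  | sup x hx y hy ihx ihy =>
    obtain ⟨J, hJ⟩ := ihx
    obtain ⟨K, hK⟩ := ihy
    exact ⟨J ∪ K, fun p q h => or_congr
      (hJ p q fun j hj => h j (Finset.mem_union_left _ hj))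
      (hK p q fun j hj => h j (Finset.mem_union_right _ hj))⟩
  | compl x hx ih =>
    obtain ⟨J, hJ⟩ := ih
    exact ⟨J, fun p q h => not_congr (hJ p q h)⟩

theorem FreeBA.exists_mem_of_ne_bot {a : FreeBA κ} (ha : a ≠ ⊥) :
    ∃ p, p ∈ (a : Set (κ → Bool)) :=
  Set.nonempty_iff_ne_empty.2 fun h => ha (Subtype.ext h)

theorem FreeBA.ne_bot_of_mem {a : FreeBA κ} {p : κ → Bool} (h : p ∈ (a : Set (κ → Bool))) :
    a ≠ ⊥ := by
  rintro rfl
  exact h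

theorem FreeBA.exists_split [Infinite κ] {a : FreeBA κ} (ha : a ≠ ⊥) :
    ∃ b c : FreeBA κ, b ≠ ⊥ ∧ c ≠ ⊥ ∧ b ≤ a ∧ c ≤ a ∧ b ⊓ c = ⊥ := by
  classical
  obtain ⟨p, hp⟩ := FreeBA.exists_mem_of_ne_bot ha
  obtain ⟨J, hJ⟩ := FreeBA.exists_finset_support a
  -- A coordinate outside the support can be flipped without leaving `a`.
  obtain ⟨α, hα⟩ := Infinite.exists_notMem_finset J
  have hmem : ∀ v, Function.update p α v ∈ (a : Set (κ → Bool)) := fun v =>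
    (hJ p _ fun j hj => by rw [Function.update_of_ne (ne_of_mem_of_not_mem hj hα)]).1 hp
  refine ⟨a ⊓ FreeBA.gen α, a ⊓ (FreeBA.gen α)ᶜ,
    FreeBA.ne_bot_of_mem (p := Function.update p α true) ⟨hmem _, ?_⟩,
    FreeBA.ne_bot_of_mem (p := Function.update p α false) ⟨hmem _, ?_⟩,
    inf_le_left, inf_le_left, ?_⟩
  · exact Function.update_self α true p
  · intro h
    have h : Function.update p α false α = true := h
    simp at h
  · rw [inf_inf_inf_comm, inf_compl_eq_bot, inf_bot_eq]

/-- The free Boolean algebras satisfy the countable chain condition. -/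
theorem FreeBA.countable_of_pairwise_inf_eq_bot {ι : Type*} (t : ι → FreeBA κ)
    (h0 : ∀ i, t i ≠ ⊥) (hd : ∀ i j, i ≠ j → t i ⊓ t j = ⊥) : Countable ι := by
  choose q hq using fun i => FreeBA.exists_mem_of_ne_bot (h0 i)
  choose J hJ using fun i => FreeBA.exists_finset_support (t i)
  let C : ι → Set (κ → Bool) := fun i => Set.pi (J i) fun α => {q i α}
  have hC : ∀ i, C i ⊆ (t i : Set (κ → Bool)) := fun i p hp => (hJ i p (q i) hp).2 (hq i)
  -- Under the fair-coin measure each `t i` contains a cylinder of positive measure, and only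
  -- countably many disjoint sets have positive measure.
  let μ := MeasureTheory.Measure.infinitePi
    fun _ : κ => (PMF.uniformOfFintype Bool).toMeasure
  have hpos : ∀ i, 0 < μ (C i) := by
    intro i
    rw [MeasureTheory.Measure.infinitePi_pi _ (fun _ _ => MeasurableSet.singleton _)]
    refine pos_iff_ne_zero.2 (Finset.prod_ne_zero_iff.2 fun α _ => ?_)
    rw [PMF.toMeasure_apply_singleton _ _ (MeasurableSet.singleton _)]
    simp
  have := MeasureTheory.Measure.countable_meas_pos_of_disjoint_iUnion (μ := μ) (As := C)
    (fun i => MeasurableSet.pi (J i).countable_toSet fun _ _ => MeasurableSet.singleton _)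
    (fun i j hij => Set.disjoint_left.2 fun p hpi hpj => by
      have : p ∈ ((t i ⊓ t j : FreeBA κ) : Set (κ → Bool)) := ⟨hC i hpi, hC j hpj⟩
      rw [hd i j hij] at this
      exact this)
  simpa [hpos, Set.countable_univ_iff] using this

theorem FreeBA.isNFree (n : ℕ) : IsNFree n (FreeBA κ) := by
  classical
  refine ⟨_, isNFreeOver_of_lit FreeBA.generatesBA_range_gen fun F G hF hG hFG h => ?_⟩
  refine absurd h (lit_ne_bot_of_hom
    ((FreeBA κ).evalHom fun α => decide (FreeBA.gen α ∈ F)) (fun x hx => ?_) fun x hx h => ?_)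
  · obtain ⟨α, rfl⟩ := hF hx
    exact decide_eq_true hx
  · obtain ⟨α, rfl⟩ := hG hx
    exact Finset.disjoint_left.1 hFG (of_decide_eq_true h) hx

end FreeAlgebra

/-! ### The finite-cofinite algebra is 2-free over its atoms -/

section FiniteCofinite

variable {κ : Type u}

/-- The atoms of `FinCo κ`. -/
def FinCo.atom (α : κ) : FinCo κ := ⟨{α}, Or.inl (Set.finite_singleton α)⟩

theorem FinCo.atom_injective : Function.Injective (FinCo.atom (κ := κ)) := fun _ _ h =>
  Set.singleton_injective (congrArg Subtype.val h)

theorem FinCo.atom_inf_atom {α β : κ} (h : α ≠ β) : FinCo.atom α ⊓ FinCo.atom β = ⊥ :=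
  Subtype.ext (Set.singleton_inter_eq_empty.2 h)

theorem FinCo.generatesBA_range_atom : GeneratesBA (Set.range (FinCo.atom (κ := κ))) := by
  have hfin : ∀ s : Set κ, (hs : s.Finite) →
      (⟨s, Or.inl hs⟩ : FinCo κ) ∈ BooleanSubalgebra.closure (Set.range FinCo.atom) := by
    intro s hs
    induction s, hs using Set.Finite.induction_on with
    | empty => exact BooleanSubalgebra.bot_mem
    | @insert α s _ hs ih =>
      exact BooleanSubalgebra.sup_mem (BooleanSubalgebra.subset_closure (Set.mem_range_self α)) ih
  refine BooleanSubalgebra.ext fun ⟨s, hs⟩ => ⟨fun _ => trivial, fun _ => ?_⟩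
  rcases hs with hs | hs
  · exact hfin s hs
  · rw [← BooleanSubalgebra.compl_mem_iff]
    exact hfin sᶜ hs

theorem FinCo.isNFree_two [Infinite κ] : IsNFree 2 (FinCo κ) := by
  classical
  refine ⟨_, isNFreeOver_of_lit FinCo.generatesBA_range_atom fun F G hF hG hFG h => ?_⟩
  by_cases h2 : ∃ α β, α ≠ β ∧ FinCo.atom α ∈ F ∧ FinCo.atom β ∈ F
  · obtain ⟨α, β, hαβ, hα, hβ⟩ := h2
    refine ⟨![FinCo.atom α, FinCo.atom β], by simp [Fin.forall_fin_two, hα, hβ],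
      by simp [Fin.univ_succ, FinCo.atom_inf_atom hαβ]⟩
  push Not at h2
  obtain ⟨γ, hγF, hγG⟩ : ∃ γ, (∀ α, FinCo.atom α ∈ F → γ = α) ∧ FinCo.atom γ ∉ G := by
    by_cases h1 : ∃ α, FinCo.atom α ∈ F
    · obtain ⟨α, hα⟩ := h1
      exact ⟨α, fun β hβ => by_contra fun hne => h2 α β hne hα hβ, Finset.disjoint_left.1 hFG hα⟩
    · push Not at h1
      obtain ⟨γ, hγ⟩ := Infinite.exists_notMem_finset
        (G.preimage FinCo.atom FinCo.atom_injective.injOn)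
      exact ⟨γ, fun α hα => absurd hα (h1 α), by simpa using hγ⟩
  refine absurd h (lit_ne_bot_of_hom ((FinCo κ).evalHom γ) (fun x hx => ?_) fun x hx h => ?_)
  · obtain ⟨α, rfl⟩ := hF hx
    exact hγF α hx
  · obtain ⟨α, rfl⟩ := hG hx
    obtain rfl : γ = α := h
    exact hγG hx

end FiniteCofinite

/-! ### The product is 3-free -/

section ThreeFree

variable {κ : Type u}

/-- The pair of an atom and a free generator with the same index. -/
def atomGen (α : κ) : FinCo κ × FreeBA κ := (FinCo.atom α, FreeBA.gen α)

theorem atomGen_injective : Function.Injective (atomGen (κ := κ)) := fun _ _ h =>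
  FinCo.atom_injective (congrArg Prod.fst h)

theorem generatesBA_insert_range_atomGen :
    GeneratesBA (insert (⊤, ⊥) (Set.range (atomGen (κ := κ)))) := by
  set S := BooleanSubalgebra.closure (insert (⊤, ⊥) (Set.range (atomGen (κ := κ)))) with hS
  have hu : ((⊤, ⊥) : FinCo κ × FreeBA κ) ∈ S :=
    BooleanSubalgebra.subset_closure (Set.mem_insert _ _)
  have hy : ∀ α : κ, atomGen α ∈ S := fun α =>
    BooleanSubalgebra.subset_closure (Set.mem_insert_of_mem _ ⟨α, rfl⟩)
  have h1 : ∀ s : FinCo κ, (s, ⊥) ∈ S := by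
    intro s
    have hs : s ∈ BooleanSubalgebra.closure (Set.range FinCo.atom) := by
      rw [show BooleanSubalgebra.closure _ = _ from FinCo.generatesBA_range_atom]; trivial
    induction hs using BooleanSubalgebra.closure_bot_sup_induction with
    | mem x hx =>
      obtain ⟨α, rfl⟩ := hx
      simpa [atomGen] using BooleanSubalgebra.inf_mem (hy α) hu
    | bot => exact BooleanSubalgebra.bot_mem
    | sup x _ y _ ihx ihy => simpa using BooleanSubalgebra.sup_mem ihx ihy
    | compl x _ ih =>
      have := BooleanSubalgebra.sdiff_mem hu ih
      rwa [show ((⊤, ⊥) : FinCo κ × FreeBA κ) \ (x, ⊥) = (xᶜ, ⊥) from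
        Prod.ext (top_sdiff' _) bot_sdiff] at this
  have h2 : ∀ t : FreeBA κ, (⊥, t) ∈ S := by
    intro t
    have ht : t ∈ BooleanSubalgebra.closure (Set.range FreeBA.gen) := by
      rw [show BooleanSubalgebra.closure _ = _ from FreeBA.generatesBA_range_gen]; trivial
    induction ht using BooleanSubalgebra.closure_bot_sup_induction with
    | mem x hx =>
      obtain ⟨α, rfl⟩ := hx
      have := BooleanSubalgebra.sdiff_mem (hy α) hu
      rwa [show atomGen α \ (⊤, ⊥) = (⊥, FreeBA.gen α) from
        Prod.ext (sdiff_top _) sdiff_bot] at this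
    | bot => exact BooleanSubalgebra.bot_mem
    | sup x _ y _ ihx ihy => simpa using BooleanSubalgebra.sup_mem ihx ihy
    | compl x _ ih =>
      have := BooleanSubalgebra.compl_mem (BooleanSubalgebra.sup_mem hu ih)
      rwa [show (((⊤, ⊥) : FinCo κ × FreeBA κ) ⊔ (⊥, x))ᶜ = (⊥, xᶜ) from
        Prod.ext (by simp) (by simp)] at this
  refine BooleanSubalgebra.ext fun ⟨s, t⟩ => ⟨fun _ => trivial, fun _ => ?_⟩
  simpa using BooleanSubalgebra.sup_mem (h1 s) (h2 t)

theorem isNFree_three_finCo_prod_freeBA [Infinite κ] : IsNFree 3 (FinCo κ × FreeBA κ) := by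
  classical
  refine ⟨_, isNFreeOver_of_lit generatesBA_insert_range_atomGen fun F G hF hG hFG h => ?_⟩
  by_cases hu : (⊤, ⊥) ∈ F
  · by_cases h2 : ∃ α β : κ, α ≠ β ∧ atomGen α ∈ F ∧ atomGen β ∈ F
    · obtain ⟨α, β, hαβ, hα, hβ⟩ := h2
      refine ⟨![(⊤, ⊥), atomGen α, atomGen β], by simp [Fin.forall_fin_succ, hα, hβ, hu], ?_⟩
      simp [Fin.univ_succ, atomGen, FinCo.atom_inf_atom hαβ, Prod.ext_iff]
    push Not at h2
    obtain ⟨γ, hγF, hγG⟩ : ∃ γ : κ, (∀ α, atomGen α ∈ F → γ = α) ∧ atomGen γ ∉ G := by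
      by_cases h1 : ∃ α : κ, atomGen α ∈ F
      · obtain ⟨α, hα⟩ := h1
        exact ⟨α, fun β hβ => by_contra fun hne => h2 α β hne hα hβ, Finset.disjoint_left.1 hFG hα⟩
      · push Not at h1
        obtain ⟨γ, hγ⟩ := Infinite.exists_notMem_finset (G.preimage atomGen atomGen_injective.injOn)
        exact ⟨γ, fun α hα => absurd hα (h1 α), by simpa using hγ⟩
    refine absurd h (lit_ne_bot_of_hom (((FinCo κ).evalHom γ).comp (.fstHom _ _))
      (fun x hx => ?_) fun x hx h => ?_)
    · obtain rfl | ⟨α, rfl⟩ := hF hx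
      · exact Set.mem_univ γ
      · exact hγF α hx
    · obtain rfl | ⟨α, rfl⟩ := hG hx
      · exact Finset.disjoint_left.1 hFG hu hx
      · obtain rfl : γ = α := h
        exact hγG hx
  -- Without `u` among the positive members, a point of the second factor realizes any sign pattern
  -- on the pairs and makes `u` false.
  · refine absurd h (lit_ne_bot_of_hom
      (((FreeBA κ).evalHom fun α => decide (atomGen α ∈ F)).comp (.sndHom _ _))
      (fun x hx => ?_) fun x hx h => ?_)
    · obtain rfl | ⟨α, rfl⟩ := hF hx
      · exact absurd hx hu
      · exact decide_eq_true hx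
    · obtain rfl | ⟨α, rfl⟩ := hG hx
      · exact h
      · exact Finset.disjoint_left.1 hFG (of_decide_eq_true h) hx

end ThreeFree

/-! ### Changing signs on a finite set of generators -/

section Transfer

variable {A : Type} [BooleanAlgebra A] [DecidableEq A] {X : Set A}

/-- The literal over `F ∪ G ∪ H` that arises from `lit F G` by a change of sign: all elements
of `H` are taken negatively. -/
def negLit (H F G : Finset A) : A := lit (F \ H) (G ∪ H)

theorem negLit_anti {H F F' G G' : Finset A} (hF : F ⊆ F') (hG : G ⊆ G') :
    negLit H F' G' ≤ negLit H F G :=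
  lit_anti (Finset.sdiff_subset_sdiff hF subset_rfl) (Finset.union_subset_union_left hG)

theorem negLit_le (H F G : Finset A) : negLit H F G ≤ lit ∅ H :=
  lit_anti (Finset.empty_subset _) Finset.subset_union_right

/-- The positive part only shrinks, so no new disjoint pair of positive members can appear. -/
theorem PairIndependent.negLit_ne_bot (hX : PairIndependent X) {H F G : Finset A}
    (hH : (H : Set A) ⊆ X) (hF : (F : Set A) ⊆ X) (hG : (G : Set A) ⊆ X) (h : lit F G ≠ ⊥) :
    negLit H F G ≠ ⊥ := by
  intro h0
  obtain ⟨x, hx, y, hy, hxy⟩ := hX (F \ H) (G ∪ H)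
    (fun x hx => hF (Finset.mem_sdiff.1 hx).1) (by simp [hG, hH])
    (by
      refine Finset.disjoint_left.2 fun x hx hx' => ?_
      rw [Finset.mem_sdiff] at hx
      rcases Finset.mem_union.1 hx' with hx' | hx'
      · exact h (lit_eq_bot_of_mem hx.1 hx')
      · exact hx.2 hx') h0
  exact h (le_bot_iff.1 (hxy ▸ le_inf (lit_le_of_mem_left (Finset.mem_sdiff.1 hx).1)
    (lit_le_of_mem_left (Finset.mem_sdiff.1 hy).1)))

theorem negLit_inf_eq_bot_of_mem {H F G F' G' : Finset A} (hH : F ∩ H = F' ∩ H)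
    (h' : lit F' G' ≠ ⊥) {x : A} (hF : x ∈ F) (hG : x ∈ G') :
    negLit H F G ⊓ negLit H F' G' = ⊥ := by
  have hxH : x ∉ H := fun hx => h' (lit_eq_bot_of_mem
    (Finset.mem_inter.1 (hH ▸ Finset.mem_inter.2 ⟨hF, hx⟩)).1 hG)
  rw [negLit, negLit, ← lit_union]
  exact lit_eq_bot_of_mem (x := x) (by simp [hF, hxH]) (by simp [hG])

/-- The change of signs preserves the disjointness of literals with the same signs on `H`. -/
theorem PairIndependent.negLit_inf_eq_bot (hX : PairIndependent X) {H F G F' G' : Finset A}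
    (hF : (F : Set A) ⊆ X) (hG : (G : Set A) ⊆ X) (hF' : (F' : Set A) ⊆ X)
    (hG' : (G' : Set A) ⊆ X) (h : lit F G ≠ ⊥) (h' : lit F' G' ≠ ⊥)
    (hH : F ∩ H = F' ∩ H)
    (h0 : lit F G ⊓ lit F' G' = ⊥) : negLit H F G ⊓ negLit H F' G' = ⊥ := by
  by_cases hd : Disjoint (F ∪ F') (G ∪ G')
  · obtain ⟨x, hx, y, hy, hxy⟩ := hX (F ∪ F') (G ∪ G') (by simp [hF, hF']) (by simp [hG, hG']) hd
      (by rw [lit_union, h0])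
    have key : ∀ {E K : Finset A}, lit E K ≠ ⊥ → x ∈ E → y ∈ E → False := fun hE hx hy =>
      hE (le_bot_iff.1 (hxy ▸ le_inf (lit_le_of_mem_left hx) (lit_le_of_mem_left hy)))
    have hmem : ∀ {z}, z ∈ H → (z ∈ F ↔ z ∈ F') := fun {z} hz => by
      simpa [hz] using Finset.ext_iff.1 hH z
    -- A member of `H` is positive in both literals or in neither. So if `x ∈ H`, the disjoint pair
    -- `x, y` would already annihilate one of them.
    have hxH : x ∉ H := fun hxH => by
      rcases Finset.mem_union.1 hy with hy | hy
      · exact key h ((Finset.mem_union.1 hx).elim id (hmem hxH).2) hy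
      · exact key h' ((Finset.mem_union.1 hx).elim (hmem hxH).1 id) hy
    have hyH : y ∉ H := fun hyH => by
      rcases Finset.mem_union.1 hx with hx | hx
      · exact key h hx ((Finset.mem_union.1 hy).elim id (hmem hyH).2)
      · exact key h' hx ((Finset.mem_union.1 hy).elim (hmem hyH).1 id)
    rw [negLit, negLit, ← lit_union, ← Finset.union_sdiff_distrib]
    exact le_bot_iff.1 (hxy ▸ le_inf (lit_le_of_mem_left (Finset.mem_sdiff.2 ⟨hx, hxH⟩))
      (lit_le_of_mem_left (Finset.mem_sdiff.2 ⟨hy, hyH⟩)))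
  · obtain ⟨x, hx, hx'⟩ := Finset.not_disjoint_iff.1 hd
    rcases Finset.mem_union.1 hx with hx | hx <;> rcases Finset.mem_union.1 hx' with hx' | hx'
    · exact absurd (lit_eq_bot_of_mem hx hx') h
    · exact negLit_inf_eq_bot_of_mem hH h' hx hx'
    · rw [inf_comm]
      exact negLit_inf_eq_bot_of_mem hH.symm h hx hx'
    · exact absurd (lit_eq_bot_of_mem hx hx') h'

/-- Once all signs on `H` are fixed, a nonzero refinement cannot alter them; hence any two such
refinements agree on `H`. -/
theorem inter_eq_inter_of_lit_ne_bot {H F G F' G' : Finset A} (hH : H ⊆ F ∪ G) (hF : F ⊆ F')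
    (hG : G ⊆ G') (h' : lit F' G' ≠ ⊥) : F' ∩ H = F ∩ H := by
  refine subset_antisymm (fun x hx => ?_) (Finset.inter_subset_inter_right hF)
  rw [Finset.mem_inter] at hx ⊢
  refine ⟨(Finset.mem_union.1 (hH hx.2)).resolve_right fun hxG => ?_, hx.2⟩
  exact h' (lit_eq_bot_of_mem hx.1 (hG hxG))

/-- An uncountable disjoint family gives rise to one below the complement of any finite join of
generators. -/
theorem PairIndependent.exists_uncountable_disjoint (hX : PairIndependent X) (hg : GeneratesBA X)
    {H : Finset A} (hH : (H : Set A) ⊆ X) {ι : Type*} [Uncountable ι] (t : ι → A)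
    (h0 : ∀ i, t i ≠ ⊥) (hd : ∀ i j, i ≠ j → t i ⊓ t j = ⊥) :
    ∃ I : Set ι, Uncountable I ∧ ∃ b : I → A, (∀ i, b i ≠ ⊥) ∧ (∀ i, b i ≤ lit ∅ H) ∧
      ∀ i j, i ≠ j → b i ⊓ b j = ⊥ := by
  choose F G hF hG hne hle using fun i => exists_lit_le (X := X) (a := t i)
    (by rw [show BooleanSubalgebra.closure X = ⊤ from hg]; trivial) (h0 i)
  -- Pigeonhole: only finitely many sign patterns on `H` occur, so one is shared by uncountably many
  -- literals.
  obtain ⟨S, hS⟩ : ∃ S : H.powerset, ¬ {i | F i ∩ H = S}.Countable := by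
    by_contra! hc
    refine not_countable (α := ι) (Set.countable_univ_iff.1 ?_)
    refine (Set.countable_iUnion hc).mono fun i _ => Set.mem_iUnion.2 ?_
    exact ⟨⟨F i ∩ H, Finset.mem_powerset.2 Finset.inter_subset_right⟩, rfl⟩
  refine ⟨{i | F i ∩ H = S}, ⟨fun hc => hS (Set.countable_coe_iff.1 hc)⟩,
    fun i => negLit H (F i) (G i), fun i => hX.negLit_ne_bot hH (hF i) (hG i) (hne i),
    fun i => negLit_le _ _ _, fun i j hij => ?_⟩
  refine hX.negLit_inf_eq_bot (hF i) (hG i) (hF j) (hG j) (hne i) (hne j)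
    (i.2.trans j.2.symm) (le_bot_iff.1 ?_)
  exact hd i j (fun h => hij (Subtype.ext h)) ▸ inf_le_inf (hle i) (hle j)

end Transfer

/-! ### No pair-independent set generates the product -/

section NotTwoFree

variable {κ : Type}

theorem not_pairIndependent_of_generatesBA [Uncountable κ] {X : Set (FinCo κ × FreeBA κ)}
    (hg : GeneratesBA X) : ¬ PairIndependent X := by
  classical
  intro hX
  obtain ⟨H, hH, hdec⟩ := exists_finset_lit_decides (X := X) (a := ((⊤, ⊥) : FinCo κ × FreeBA κ))
    (by rw [show BooleanSubalgebra.closure X = ⊤ from hg]; trivial)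
  rcases hdec ∅ H fun x hx => Or.inr hx with he | he
  · have hsplit : ∀ F G : Finset (FinCo κ × FreeBA κ), (F : Set _) ⊆ X → (G : Set _) ⊆ X →
        H ⊆ F ∪ G → lit F G ≠ ⊥ → lit F G ≤ (⊥, ⊤) →
        ∃ F₁ G₁ F₂ G₂ : Finset (FinCo κ × FreeBA κ),
          ((F₁ : Set _) ⊆ X ∧ (G₁ : Set _) ⊆ X ∧ H ⊆ F₁ ∪ G₁ ∧ lit F₁ G₁ ≠ ⊥ ∧
            lit F₁ G₁ ≤ (⊥, ⊤)) ∧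
          ((F₂ : Set _) ⊆ X ∧ (G₂ : Set _) ⊆ X ∧ H ⊆ F₂ ∪ G₂ ∧ lit F₂ G₂ ≠ ⊥ ∧
            lit F₂ G₂ ≤ (⊥, ⊤)) ∧
          negLit H F₁ G₁ ≤ negLit H F G ∧ negLit H F₂ G₂ ≤ negLit H F G ∧
          negLit H F₁ G₁ ⊓ negLit H F₂ G₂ = ⊥ := by
      intro F G hF hG hFG h0 hle
      have hfst : (lit F G).1 = ⊥ := le_bot_iff.1 hle.1
      obtain ⟨b, c, hb, hc, hba, hca, hbc⟩ := FreeBA.exists_split (a := (lit F G).2)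
        fun h => h0 (Prod.ext hfst h)
      obtain ⟨F₁, G₁, hFF₁, hGG₁, hF₁, hG₁, h1, h1b⟩ := exists_lit_refine hg hF hG
        (a := (⊥, b)) (fun h => hb (congrArg Prod.snd h)) ⟨bot_le, hba⟩
      obtain ⟨F₂, G₂, hFF₂, hGG₂, hF₂, hG₂, h2, h2c⟩ := exists_lit_refine hg hF hG
        (a := (⊥, c)) (fun h => hc (congrArg Prod.snd h)) ⟨bot_le, hca⟩
      have hH₁ := hFG.trans (Finset.union_subset_union hFF₁ hGG₁)
      have hH₂ := hFG.trans (Finset.union_subset_union hFF₂ hGG₂)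
      refine ⟨F₁, G₁, F₂, G₂, ⟨hF₁, hG₁, hH₁, h1, (lit_anti hFF₁ hGG₁).trans hle⟩,
        ⟨hF₂, hG₂, hH₂, h2, (lit_anti hFF₂ hGG₂).trans hle⟩, negLit_anti hFF₁ hGG₁,
        negLit_anti hFF₂ hGG₂, hX.negLit_inf_eq_bot hF₁ hG₁ hF₂ hG₂ h1 h2 ?_ ?_⟩
      · rw [inter_eq_inter_of_lit_ne_bot hFG hFF₁ hGG₁ h1,
          inter_eq_inter_of_lit_ne_bot hFG hFF₂ hGG₂ h2]
      · refine le_bot_iff.1 ((inf_le_inf h1b h2c).trans ⟨inf_le_left, ?_⟩)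
        exact hbc.le
    have hneg : ∀ F G : Finset (FinCo κ × FreeBA κ), (F : Set _) ⊆ X → (G : Set _) ⊆ X →
        lit F G ≠ ⊥ → ((negLit H F G).1 : Set κ).Nonempty := by
      intro F G hF hG h0
      refine Set.nonempty_iff_ne_empty.2 fun h => hX.negLit_ne_bot hH hF hG h0 (Prod.ext ?_ ?_)
      · exact Subtype.ext h
      · exact le_bot_iff.1 ((negLit_le H F G).trans he).2
    have hdisj : ∀ {a b : FinCo κ × FreeBA κ}, a ⊓ b = ⊥ → Disjoint (a.1 : Set κ) (b.1 : Set κ) :=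
      fun {a b} h => Set.disjoint_iff_inter_eq_empty.2
        (congrArg (fun z : FinCo κ × FreeBA κ => (z.1 : Set κ)) h)
    -- A finite transferred set would contain a strictly smaller one of the same kind: infinite
    -- descent on cardinality.
    have hinf : ∀ n, ∀ F G : Finset (FinCo κ × FreeBA κ), (F : Set _) ⊆ X → (G : Set _) ⊆ X →
        H ⊆ F ∪ G → lit F G ≠ ⊥ → lit F G ≤ (⊥, ⊤) → ((negLit H F G).1 : Set κ).Finite →
        ((negLit H F G).1 : Set κ).ncard ≠ n := by
      intro n
      induction n using Nat.strong_induction_on with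
      | _ n ih =>
        rintro F G hF hG hFG h0 hle hfin rfl
        obtain ⟨F₁, G₁, F₂, G₂, ⟨hF₁, hG₁, hH₁, h1, h1'⟩, ⟨hF₂, hG₂, -, h2, -⟩, hle₁, hle₂, hd⟩ :=
          hsplit F G hF hG hFG h0 hle
        have hsub : ((negLit H F₁ G₁).1 : Set κ) ⊂ (negLit H F G).1 := by
          refine Set.ssubset_iff_subset_ne.2 ⟨hle₁.1, fun heq => ?_⟩
          obtain ⟨k, hk⟩ := hneg F₂ G₂ hF₂ hG₂ h2
          exact Set.disjoint_left.1 (hdisj hd) (heq ▸ hle₂.1 hk) hk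
        exact ih _ (Set.ncard_lt_ncard hsub hfin) F₁ G₁ hF₁ hG₁ hH₁ h1 h1'
          (hfin.subset hsub.subset) rfl
    obtain ⟨F, G, hF, hG, hFG, h0, hle⟩ := exists_lit_le_of_finset hg hH
      (a := ((⊥, ⊤) : FinCo κ × FreeBA κ)) (fun h => FreeBA.ne_bot_of_mem
        (a := ⊤) (p := fun _ => true) trivial (congrArg Prod.snd h))
    obtain ⟨F₁, G₁, F₂, G₂, ⟨hF₁, hG₁, hH₁, h1, h1'⟩, ⟨hF₂, hG₂, hH₂, h2, h2'⟩, -, -, hd⟩ :=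
      hsplit F G hF hG hFG h0 hle
    -- Two disjoint members of `FinCo κ` cannot both be infinite.
    have hco := (negLit H F₁ G₁).1.2.resolve_left fun hfin =>
      hinf _ F₁ G₁ hF₁ hG₁ hH₁ h1 h1' hfin rfl
    exact hinf _ F₂ G₂ hF₂ hG₂ hH₂ h2 h2' (hco.subset (hdisj hd).subset_compl_left) rfl
  · obtain ⟨I, hI, b, hb0, hble, hbd⟩ := hX.exists_uncountable_disjoint hg hH
      (fun α : κ => ((FinCo.atom α, ⊥) : FinCo κ × FreeBA κ))
      (fun α h => Set.singleton_ne_empty α (congrArg (fun z => (z.1 : Set κ)) h))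
      (fun α β h => by simp [FinCo.atom_inf_atom h, Prod.ext_iff])
    refine not_countable (α := I) (FreeBA.countable_of_pairwise_inf_eq_bot (fun i => (b i).2)
      (fun i h => hb0 i (Prod.ext ?_ h)) fun i j hij => congrArg Prod.snd (hbd i j hij))
    have := ((hble i).trans he).1
    simpa using this

end NotTwoFree

instance : Uncountable Omega1 := by
  rw [← Cardinal.aleph0_lt_mk_iff, Cardinal.mk_toType]
  simp

theorem mainTheorem5 :
    (¬ IsNFree 2 (FinCo Omega1 × FreeBA Omega1) ∧
      ¬ ∃ X : Set (FinCo Omega1 × FreeBA Omega1), GeneratesBA X ∧ IsNIndependent 2 X) ∧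
    (IsNFree 2 (FinCo Omega1) ∧ IsNFree 2 (FreeBA Omega1)) ∧
    IsNFree 3 (FinCo Omega1 × FreeBA Omega1) := by
  have : Nontrivial (FinCo Omega1 × FreeBA Omega1) :=
    ⟨⊥, ⊤, fun h => FreeBA.ne_bot_of_mem (a := ⊤) (p := fun _ => true) trivial
      (congrArg Prod.snd h.symm)⟩
  exact ⟨⟨fun ⟨_, h⟩ => not_pairIndependent_of_generatesBA h.generatesBA h.pairIndependent,
    fun ⟨_, hg, h⟩ => not_pairIndependent_of_generatesBA hg h.pairIndependent⟩,
    ⟨FinCo.isNFree_two, FreeBA.isNFree 2⟩, isNFree_three_finCo_prod_freeBA⟩
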